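/- **Setting.** Let $\mathcal X$ be a separable metric space, $\mathcal Y\subset\mathbb R$ closed, and $\mathcal X_1,\dots,\mathcal X_B\subset\mathcal X$ (possibly overlapping) regions, each of which is a complete (separable) metric space. Let $w_b:\mathcal X\to[0,1]$ ($b=1,\dots,B$) be measurable weights with $\sum_{b=1}^B w_b(x)=1$ for all $x\in\mathcal X$ and $w_b(x)=0$ for $x\notin\mathcal X_b$, and let $\lambda_b>0$. For each $b$ let $H_b$ be a (real) RKHS of functions on $\mathcal X_b$ with bounded and continuous kernel $k_b$. Let $L:\mathcal Y\times\mathbb R\to[0,\infty)$ be a measurable loss function that is convex in its last argument and Lipschitz continuous in its last argument with constant $|L|_1$ (uniformly in $y$), such that for every $y$ the function $L(y,\cdot)$ has continuous derivatives $L'(y,\cdot)$ and $L''(y,\cdot)$, with $\sup_{y\in\mathcal Y}\sup_{t\in\mathbb R}|L'(y,t)|\in(0,\infty)$ and $\sup_{y\in\mathcal Y}\sup_{t\in\mathbb R}|L''(y,t)|<\infty$. Put $L^\star(y,t)=L(y,t)-L(y,0)$. For a probability measure $\mu$ on $\mathcal X_b\times\mathcal Y$ the local SVM $f_{b,L^\star,\mu,\lambda_b}\in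 H_b$ is the minimizer over $f\in H_b$ of $\int L^\star(y,f(x))\,d\mu(x,y)+\lambda_b\|f\|_{H_b}^2$; if $\mu$ is not a probability measure, $f_{b,L^\star,\mu,\lambda_b}$ is an arbitrary measurable function on $\mathcal X_b$. For a distribution $P$ on $\mathcal X\times\mathcal Y$ let $P_b$ be the restriction of $P$ to $\mathcal X_b\times\mathcal Y$ divided by $P(\mathcal X_b\times\mathcal Y)$ if this number is positive, and the null measure otherwise; $Q_b$ is defined from $Q$ in the same way. Let $\tilde P_{b,\varepsilon,Q}:=(1-\varepsilon)P_b+\varepsilon Q_b$ if $Q_b\ne0$ and $\tilde P_{b,\varepsilon,Q}:=P_b$ otherwise. The composed predictor learned from $P$, and the composed predictor learned under contamination of $P$ by a fraction $\varepsilon$ of $Q$, are $$f^{comp}_{P}=\sum_{b=1}^B w_b\, f_{b,L^\star,P_b,\lambda_b},\qquad f^{comp}_{\varepsilon,P,Q}=\sum_{b=1}^B w_b\, f_{b,L^\star,\tilde P_{b,\varepsilon,Q},\lambda_b}$$ (each local predictor being extended by $0$ outside $\mathcal X_b$). With $P^{\mathcal X}$ the marginal of $P$ on $\mathcal X$, the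 composed influence function is $$\mathrm{IF}^{comp}(Q;S,P):=\lim_{\varepsilon\downarrow0}\frac{f^{comp}_{\varepsilon,P,Q}-f^{comp}_{P}}{\varepsilon}\quad\text{in }L^\infty(P^{\mathcal X}),$$ if this limit exists. **Statement.** The local SVMs exist and are unique for all probability measures on $\mathcal X_b\times\mathcal Y$, $b=1,\dots,B$. For all probability distributions $P$ and $Q$ on $\mathcal X\times\mathcal Y$ the composed predictors $f^{comp}_P$ and $f^{comp}_{\varepsilon,P,Q}$ ($0\le\varepsilon\le1$) belong to $L^\infty(P^{\mathcal X})$, the influence function $\mathrm{IF}^{comp}(Q;S,P)$ exists, and $$\|\mathrm{IF}^{comp}(Q;S,P)\|_{L^\infty(P^{\mathcal X})}\ \le\ 2\,|L|_1\sum_{b=1}^B\|w_b\|_{\mathcal X_b\text{-}\infty}\,\lambda_b^{-1}\,\|k_b\|_{\mathcal X_b\text{-}\infty}^2,$$ where $\|w_b\|_{\mathcal X_b\text{-}\infty}=\sup_{x\in\mathcal X_b}w_b(x)$ and $\|k_b\|_{\mathcal X_b\text{-}\infty}=\sup_{x\in\mathcal X_b}\sqrt{k_b(x,x)}$. The bound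 does not depend on $P$ or $Q$. -/

import Mathlib

open MeasureTheory Filter Set
open scoped Topology ENNReal NNReal

noncomputable section

namespace LocalSVM

/-- The shifted loss `L*(y,t) = L(y,t) - L(y,0)`. -/
def shiftedLoss {𝒴 : Type*} (L : 𝒴 → ℝ → ℝ) (y : 𝒴) (t : ℝ) : ℝ :=
  L y t - L y 0

/-- The real-valued reproducing kernel `k(x,x')` of a real RKHS `H` of functions on `A`.
(Mathlib's kernel takes values in the linear maps `ℝ → ℝ`, i.e. multiplications by a scalar.) -/
def realKernel {A : Type*} (H : Type*) [NormedAddCommGroup H] [InnerProductSpace ℝ H]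
    [CompleteSpace H] [RKHS ℝ H A ℝ] (x x' : A) : ℝ :=
  RKHS.kernel H x x' 1

/-- `‖k‖_∞ = sup_x √(k(x,x))`, the supremum being over the domain of the functions in `H`. -/
def kernelSup {A : Type*} (H : Type*) [NormedAddCommGroup H] [InnerProductSpace ℝ H]
    [CompleteSpace H] [RKHS ℝ H A ℝ] : ℝ :=
  ⨆ x : A, √(realKernel H x x)

/-- The kernel of `H` is bounded: `sup_x √(k(x,x)) < ∞`. -/
def BoundedKernel {A : Type*} (H : Type*) [NormedAddCommGroup H] [InnerProductSpace ℝ H]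
    [CompleteSpace H] [RKHS ℝ H A ℝ] : Prop :=
  BddAbove (range fun x : A => √(realKernel H x x))

/-- The kernel of `H` is continuous (jointly in its two arguments). -/
def ContinuousKernel {A : Type*} [TopologicalSpace A] (H : Type*) [NormedAddCommGroup H]
    [InnerProductSpace ℝ H] [CompleteSpace H] [RKHS ℝ H A ℝ] : Prop :=
  Continuous fun p : A × A => realKernel H p.1 p.2

/-- The regularized theoretical risk `∫ L*(y, f(x)) dμ(x,y) + lam ‖f‖_H²`. -/
def regRisk {A 𝒴 H : Type*} [MeasurableSpace A] [MeasurableSpace 𝒴] [NormedAddCommGroup H]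
    [InnerProductSpace ℝ H] [RKHS ℝ H A ℝ] (L : 𝒴 → ℝ → ℝ) (lam : ℝ)
    (μ : Measure (A × 𝒴)) (f : H) : ℝ :=
  ∫ p, shiftedLoss L p.2 (f p.1) ∂μ + lam * ‖f‖ ^ 2

/-- `f ∈ H` is a (theoretical) support vector machine for `μ`: it minimizes the regularized risk
over `H`. -/
def IsSVM {A 𝒴 H : Type*} [MeasurableSpace A] [MeasurableSpace 𝒴] [NormedAddCommGroup H]
    [InnerProductSpace ℝ H] [RKHS ℝ H A ℝ] (L : 𝒴 → ℝ → ℝ) (lam : ℝ)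
    (μ : Measure (A × 𝒴)) (f : H) : Prop :=
  ∀ h : H, regRisk L lam μ f ≤ regRisk L lam μ h

open Classical in
/-- The local predictor learned from the measure `μ`: the SVM if `μ` is a probability measure,
and an arbitrary function `g μ` otherwise. -/
def localPredictor {A 𝒴 : Type*} [MeasurableSpace A] [MeasurableSpace 𝒴] (H : Type*)
    [NormedAddCommGroup H] [InnerProductSpace ℝ H] [RKHS ℝ H A ℝ] (L : 𝒴 → ℝ → ℝ) (lam : ℝ)
    (g : Measure (A × 𝒴) → A → ℝ) (μ : Measure (A × 𝒴)) : A → ℝ :=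
  if IsProbabilityMeasure μ then ⇑(Classical.epsilon fun f : H => IsSVM L lam μ f) else g μ

/-- The regional distribution of `P` on `A × 𝒴`: the restriction of `P` normalized by
`P(A × 𝒴)`, and the null measure if `P(A × 𝒴) = 0`. -/
def regional {X 𝒴 : Type*} [MeasurableSpace X] [MeasurableSpace 𝒴]
    (P : Measure (X × 𝒴)) (A : Set X) : Measure (A × 𝒴) :=
  (ProbabilityTheory.cond P (A ×ˢ univ)).comap (Prod.map Subtype.val id)

open Classical in
/-- The contaminated regional distribution: `(1 - ε) P_b + ε Q_b` if `Q_b ≠ 0`, and `P_b`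
otherwise. -/
def contaminated {X 𝒴 : Type*} [MeasurableSpace X] [MeasurableSpace 𝒴]
    (P Q : Measure (X × 𝒴)) (A : Set X) (ε : ℝ) : Measure (A × 𝒴) :=
  if regional Q A ≠ 0 then
    ENNReal.ofReal (1 - ε) • regional P A + ENNReal.ofReal ε • regional Q A
  else regional P A

open Classical in
/-- The composed predictor `x ↦ ∑_b w_b(x) f_b(x)`, where the local predictor `f_b` is learned
from the measure `ν b` on `R b × 𝒴` (and is extended by zero outside the region `R b`). -/
def composedPredictor {X 𝒴 : Type*} [MeasurableSpace X] [MeasurableSpace 𝒴] {B : ℕ}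
    (R : Fin B → Set X) (H : Fin B → Type*) [∀ b, NormedAddCommGroup (H b)]
    [∀ b, InnerProductSpace ℝ (H b)] [∀ b, RKHS ℝ (H b) (R b) ℝ]
    (w : Fin B → X → ℝ) (L : 𝒴 → ℝ → ℝ) (lam : Fin B → ℝ)
    (g : ∀ b, Measure (R b × 𝒴) → R b → ℝ) (ν : ∀ b, Measure (R b × 𝒴)) (x : X) : ℝ :=
  ∑ b, w b x *
    (if hx : x ∈ R b then localPredictor (H b) L (lam b) (g b) (ν b) ⟨x, hx⟩ else 0)

/-- `G ∈ L^∞(P^X)` is the influence function of the composed predictor at `P` in the direction of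
the contaminating distribution `Q`: the composed predictors learned from `P` and from the
contaminated regional distributions belong to `L^∞(P^X)`, and their difference quotient in `ε`
converges to `G` in `L^∞(P^X)` as `ε ↓ 0`. -/
def IsInfluenceFunction {X 𝒴 : Type*} [MeasurableSpace X] [MeasurableSpace 𝒴] {B : ℕ}
    (R : Fin B → Set X) (H : Fin B → Type*) [∀ b, NormedAddCommGroup (H b)]
    [∀ b, InnerProductSpace ℝ (H b)] [∀ b, RKHS ℝ (H b) (R b) ℝ]
    (w : Fin B → X → ℝ) (L : 𝒴 → ℝ → ℝ) (lam : Fin B → ℝ)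
    (g : ∀ b, Measure (R b × 𝒴) → R b → ℝ) (P Q : Measure (X × 𝒴))
    (G : Lp ℝ ∞ P.fst) : Prop :=
  MemLp (composedPredictor R H w L lam g fun b => regional P (R b)) ∞ P.fst ∧
  (∀ ε ∈ Icc (0 : ℝ) 1,
    MemLp (composedPredictor R H w L lam g fun b => contaminated P Q (R b) ε) ∞ P.fst) ∧
  Tendsto
    (fun ε : ℝ => eLpNorm
      (fun x =>
        (composedPredictor R H w L lam g (fun b => contaminated P Q (R b) ε) x
          - composedPredictor R H w L lam g (fun b => regional P (R b)) x) / ε - G x)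
      ∞ P.fst)
    (𝓝[>] 0) (𝓝 0)

end LocalSVM

end

/-! On each region of positive `P`-mass the claim is an implicit function argument in the RKHS.
Write `∇μ(f) = ∫ L'(y, f(x)) k(·, x) dμ`. The SVM exists because the regularized risk is strongly
convex, and it satisfies `2λ f + ∇μ(f) = 0`. The map `∇μ` is monotone, as `L` is convex, and bounded
by `Kκ`.

Let `F ε` be the SVM of `(1 - ε)μ + εν`. Subtracting the two optimality conditions and pairing with
`F ε - f` removes the monotone term and leaves `‖F ε - f‖ ≤ Kκε/λ` (`norm_contaminated_sub_le`).
With this linear rate, dominated convergence linearizes `∇μ` along the curve `F`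
(`tendsto_riskGradient_remainder`). The operator `T = 2λ + riskHessian` is invertible by
Lax–Milgram, so `(F ε - f)/ε` converges to `u = -T⁻¹(∇ν(f) - ∇μ(f))`, and `‖u‖ ≤ Kκ/λ` is inherited
from the Lipschitz bound (`exists_influence`).

Evaluation costs a further factor `κ`, so convergence in the RKHS is uniform convergence on the
region. Composition is linear in the local functions, and regions of mass zero, where the predictors
are arbitrary, are invisible in `L^∞(P^X)` (`ae_abs_compose_le`). -/

noncomputable section

namespace LocalSVM

open scoped InnerProductSpace

/-! ### Smooth convex losses -/

/-- A measurable loss function, convex and `K`-Lipschitz in its last argument, with continuous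
first derivative and second derivative bounded by `M` in the last argument. -/
structure SmoothLoss {𝒴 : Type*} [MeasurableSpace 𝒴] (L : 𝒴 → ℝ → ℝ) (K M : ℝ≥0) : Prop where
  measurable : Measurable fun p : 𝒴 × ℝ => L p.1 p.2
  convex : ∀ y, ConvexOn ℝ univ (L y)
  lipschitz : ∀ y, LipschitzWith K (L y)
  differentiable : ∀ y, Differentiable ℝ (L y)
  differentiable_deriv : ∀ y, Differentiable ℝ (deriv (L y))
  abs_deriv2_le : ∀ y t, |deriv (deriv (L y)) t| ≤ M

/-- The derivative is a pointwise limit of difference quotients with step `1/(n+1)`, each jointly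
measurable. Applied to `L` and then to `L'`, this makes the integrands of gradient and Hessian
measurable. -/
theorem measurable_deriv_snd {𝒴 : Type*} [MeasurableSpace 𝒴] {L : 𝒴 → ℝ → ℝ}
    (hL : Measurable fun p : 𝒴 × ℝ => L p.1 p.2) (hd : ∀ y, Differentiable ℝ (L y)) :
    Measurable fun p : 𝒴 × ℝ => deriv (L p.1) p.2 := by
  refine measurable_of_tendsto_metrizable
    (f := fun (n : ℕ) (p : 𝒴 × ℝ) =>
      ((1 : ℝ) / (n + 1))⁻¹ • (L p.1 (p.2 + 1 / (n + 1)) - L p.1 p.2)) (fun n => ?_) ?_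
  · have h : Measurable fun p : 𝒴 × ℝ => L p.1 (p.2 + 1 / ((n : ℝ) + 1)) :=
      hL.comp (measurable_fst.prodMk (measurable_snd.add_const _))
    exact (h.sub hL).const_smul ((1 : ℝ) / (n + 1))⁻¹
  · rw [tendsto_pi_nhds]
    intro p
    have h := (hd p.1 p.2).hasDerivAt.tendsto_slope_zero
    refine h.comp (tendsto_nhdsWithin_iff.2 ⟨tendsto_one_div_add_atTop_nhds_zero_nat, ?_⟩)
    exact Eventually.of_forall fun n => by
      simp only [mem_compl_iff, mem_singleton_iff]; positivity

namespace SmoothLoss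

variable {𝒴 : Type*} [MeasurableSpace 𝒴] {L : 𝒴 → ℝ → ℝ} {K M : ℝ≥0}

theorem abs_deriv_le (h : SmoothLoss L K M) (y : 𝒴) (t : ℝ) : |deriv (L y) t| ≤ K :=
  norm_deriv_le_of_lipschitz (h.lipschitz y)

theorem monotone_deriv (h : SmoothLoss L K M) (y : 𝒴) : Monotone (deriv (L y)) :=
  monotoneOn_univ.1 ((h.convex y).monotoneOn_deriv fun t _ => h.differentiable y t)

theorem deriv2_nonneg (h : SmoothLoss L K M) (y : 𝒴) (t : ℝ) : 0 ≤ deriv (deriv (L y)) t :=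
  (h.monotone_deriv y).deriv_nonneg

theorem abs_deriv_sub_le (h : SmoothLoss L K M) (y : 𝒴) (s t : ℝ) :
    |deriv (L y) s - deriv (L y) t| ≤ M * |s - t| :=
  convex_univ.norm_image_sub_le_of_norm_deriv_le (𝕜 := ℝ)
    (fun x _ => h.differentiable_deriv y x) (fun x _ => h.abs_deriv2_le y x)
    (mem_univ t) (mem_univ s)

theorem abs_shiftedLoss_sub_le (h : SmoothLoss L K M) (y : 𝒴) (s t : ℝ) :
    |shiftedLoss L y s - shiftedLoss L y t| ≤ K * |s - t| := by
  simpa [shiftedLoss, Real.dist_eq] using (h.lipschitz y).dist_le_mul s t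

theorem abs_shiftedLoss_le (h : SmoothLoss L K M) (y : 𝒴) (t : ℝ) :
    |shiftedLoss L y t| ≤ K * |t| := by
  simpa [shiftedLoss] using h.abs_shiftedLoss_sub_le y t 0

theorem measurable_deriv (h : SmoothLoss L K M) :
    Measurable fun p : 𝒴 × ℝ => deriv (L p.1) p.2 :=
  measurable_deriv_snd h.measurable h.differentiable

theorem measurable_deriv2 (h : SmoothLoss L K M) :
    Measurable fun p : 𝒴 × ℝ => deriv (deriv (L p.1)) p.2 :=
  measurable_deriv_snd (L := fun y => deriv (L y)) h.measurable_deriv h.differentiable_deriv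

theorem measurable_shiftedLoss (h : SmoothLoss L K M) :
    Measurable fun p : 𝒴 × ℝ => shiftedLoss L p.1 p.2 :=
  h.measurable.sub (h.measurable.comp (measurable_fst.prodMk measurable_const))

end SmoothLoss

/-! ### Feature map and reproducing property -/

section FeatureMap

variable {A : Type*} (H : Type*) [NormedAddCommGroup H] [InnerProductSpace ℝ H]
  [CompleteSpace H] [RKHS ℝ H A ℝ]

/-- The canonical feature map `x ↦ k(·, x)`. -/
def featureMap (x : A) : H := RKHS.kerFun H x 1

theorem featureMap_inner (x : A) (f : H) : ⟪featureMap H x, f⟫_ℝ = f x := by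
  simp [featureMap]

theorem featureMap_inner_featureMap (x x' : A) :
    ⟪featureMap H x, featureMap H x'⟫_ℝ = realKernel H x x' := by
  rw [featureMap_inner, featureMap, RKHS.kerFun_apply, realKernel]

theorem norm_featureMap (x : A) : ‖featureMap H x‖ = √(realKernel H x x) := by
  rw [← featureMap_inner_featureMap, real_inner_self_eq_norm_sq, Real.sqrt_sq (norm_nonneg _)]

/-- The squared distance of two feature vectors expands into kernel values, which are continuous and
cancel on the diagonal. -/
theorem continuous_featureMap [TopologicalSpace A] (hk : ContinuousKernel (A := A) H) :
    Continuous (featureMap H : A → H) := by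
  refine continuous_iff_continuousAt.2 fun x => ?_
  rw [ContinuousAt, tendsto_iff_norm_sub_tendsto_zero]
  have h1 : ∀ x', ‖featureMap H x' - featureMap H x‖
      = √(realKernel H x' x' - 2 * realKernel H x' x + realKernel H x x) := by
    intro x'
    rw [← featureMap_inner_featureMap, ← featureMap_inner_featureMap,
      ← featureMap_inner_featureMap, real_inner_self_eq_norm_sq, real_inner_self_eq_norm_sq,
      ← norm_sub_sq_real, Real.sqrt_sq (norm_nonneg _)]
  simp_rw [h1]
  have h2 : Continuous fun x' : A =>
      √(realKernel H x' x' - 2 * realKernel H x' x + realKernel H x x) := by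
    have ha : Continuous fun x' : A => realKernel H x' x' :=
      Continuous.comp (g := fun p : A × A => realKernel H p.1 p.2) hk
        (f := fun x' => (x', x')) (by fun_prop)
    have hb : Continuous fun x' : A => realKernel H x' x :=
      Continuous.comp (g := fun p : A × A => realKernel H p.1 p.2) hk
        (f := fun x' => (x', x)) (by fun_prop)
    exact ((ha.sub (hb.const_mul 2)).add_const _).sqrt
  have h3 := h2.tendsto x
  have h4 : realKernel H x x - 2 * realKernel H x x + realKernel H x x = 0 := by ring
  rwa [h4, Real.sqrt_zero] at h3

theorem norm_featureMap_le (hk : BoundedKernel (A := A) H) (x : A) :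
    ‖featureMap H x‖ ≤ kernelSup (A := A) H := by
  rw [norm_featureMap]
  exact le_ciSup hk x

theorem kernelSup_nonneg : 0 ≤ kernelSup (A := A) H :=
  Real.iSup_nonneg fun _ => Real.sqrt_nonneg _

variable {H}

/-- Cauchy–Schwarz for the reproducing property. This is the passage from the RKHS norm to the
supremum norm. -/
theorem abs_apply_le {κ : ℝ} (hκ : ∀ x : A, ‖featureMap H x‖ ≤ κ) (f : H) (x : A) :
    |f x| ≤ κ * ‖f‖ := by
  rw [← featureMap_inner]
  exact (abs_real_inner_le_norm _ _).trans (by gcongr; exact hκ x)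

theorem measurable_coe [TopologicalSpace A] [MeasurableSpace A] [OpensMeasurableSpace A]
    (hΦ : Continuous (featureMap H : A → H)) (f : H) :
    Measurable (f : A → ℝ) := by
  have : (f : A → ℝ) = fun x => ⟪featureMap H x, f⟫_ℝ := by
    funext x; rw [featureMap_inner]
  rw [this]
  exact (hΦ.inner continuous_const).measurable

theorem measurable_snd_coe_fst {𝒴 : Type*} [TopologicalSpace A] [MeasurableSpace A]
    [OpensMeasurableSpace A] [MeasurableSpace 𝒴] (hΦ : Continuous (featureMap H : A → H)) (f : H) :
    Measurable fun p : A × 𝒴 => (p.2, f p.1) :=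
  measurable_snd.prodMk ((measurable_coe hΦ f).comp measurable_fst)

end FeatureMap

/-! ### Existence, uniqueness and optimality condition of the SVM -/

/-- A continuous, bounded below and strongly midpoint convex function on a Hilbert space attains
its minimum. -/
theorem exists_forall_le_of_midpoint {E : Type*} [NormedAddCommGroup E] [NormedSpace ℝ E]
    [CompleteSpace E] {J : E → ℝ} (hc : Continuous J) (hb : BddBelow (range J)) {c : ℝ}
    (hc0 : 0 < c)
    (hmid : ∀ f g, J ((2⁻¹ : ℝ) • (f + g)) + c * ‖f - g‖ ^ 2 ≤ (J f + J g) / 2) :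
    ∃ f, ∀ g, J f ≤ J g := by
  set m := ⨅ f, J f with hm
  have hle : ∀ f, m ≤ J f := fun f => ciInf_le hb f
  have hex : ∀ n : ℕ, ∃ f, J f < m + 1 / (n + 1) := fun n =>
    exists_lt_of_ciInf_lt (by rw [← hm]; linarith [Nat.one_div_pos_of_nat (α := ℝ) (n := n)])
  choose F hF using hex
  have hanti : ∀ {N n : ℕ}, N ≤ n → (1 : ℝ) / (n + 1) ≤ 1 / (N + 1) := fun h =>
    Nat.one_div_le_one_div h
  -- A minimizing sequence is Cauchy: the value at a midpoint is at least the infimum, so `hmid`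
  -- bounds `c‖F n - F k‖²` by the excess of the two values over it.
  have hcauchy : CauchySeq F := by
    refine cauchySeq_of_le_tendsto_0 (fun N : ℕ => √(c⁻¹ * (1 / (N + 1)))) (fun n k N hn hk => ?_) ?_
    · rw [dist_eq_norm]
      refine Real.le_sqrt_of_sq_le ?_
      rw [le_inv_mul_iff₀ hc0]
      have := hmid (F n) (F k)
      have := hle ((2⁻¹ : ℝ) • (F n + F k))
      linarith [hF n, hF k, hanti hn, hanti hk]
    · have h := (tendsto_one_div_add_atTop_nhds_zero_nat (𝕜 := ℝ)).const_mul c⁻¹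
      rw [mul_zero] at h
      have h' := (Real.continuous_sqrt.tendsto 0).comp h
      rwa [Real.sqrt_zero] at h'
  obtain ⟨f, hf⟩ := cauchySeq_tendsto_of_complete hcauchy
  refine ⟨f, fun g => le_trans ?_ (hle g)⟩
  have h1 : Tendsto (fun n : ℕ => m + 1 / ((n : ℝ) + 1)) atTop (𝓝 (m + 0)) :=
    tendsto_one_div_add_atTop_nhds_zero_nat.const_add m
  rw [add_zero] at h1
  exact le_of_tendsto_of_tendsto' ((hc.tendsto f).comp hf) h1 fun n => (hF n).le

section Local

set_option linter.unusedSectionVars false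

variable {A 𝒴 H : Type*} [TopologicalSpace A] [SecondCountableTopology A] [MeasurableSpace A]
  [OpensMeasurableSpace A] [MeasurableSpace 𝒴] [NormedAddCommGroup H] [InnerProductSpace ℝ H]
  [CompleteSpace H] [RKHS ℝ H A ℝ] {L : 𝒴 → ℝ → ℝ} {K M : ℝ≥0} {lam κ : ℝ}
  {μ ν : Measure (A × 𝒴)}

/-- The gradient part `∫ L'(y, f(x)) k(·, x) dμ(x, y)` of the risk. -/
def riskGradient (L : 𝒴 → ℝ → ℝ) (μ : Measure (A × 𝒴)) (f : H) : H :=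
  ∫ p, deriv (L p.2) (f p.1) • featureMap H p.1 ∂μ

/-- `H` need not be separable: strong measurability comes from continuity on the second countable
space `A`. -/
theorem aestronglyMeasurable_smul_featureMap (hΦ : Continuous (featureMap H : A → H))
    {c : A × 𝒴 → ℝ} (hc : Measurable c) :
    AEStronglyMeasurable (fun p => c p • featureMap H p.1) μ :=
  hc.aestronglyMeasurable.smul
    (hΦ.stronglyMeasurable.comp_measurable measurable_fst).aestronglyMeasurable

theorem integrable_smul_featureMap [IsFiniteMeasure μ] (hΦ : Continuous (featureMap H : A → H))
    (hκ : ∀ x : A, ‖featureMap H x‖ ≤ κ) {c : A × 𝒴 → ℝ} (hc : Measurable c) {C : ℝ}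
    (hC : ∀ p, |c p| ≤ C) : Integrable (fun p => c p • featureMap H p.1) μ := by
  refine Integrable.of_bound (aestronglyMeasurable_smul_featureMap hΦ hc) (C * κ)
    (Eventually.of_forall fun p => ?_)
  rw [norm_smul, Real.norm_eq_abs]
  exact mul_le_mul (hC p) (hκ _) (norm_nonneg _) ((abs_nonneg _).trans (hC p))

theorem inner_integral_smul_featureMap [IsFiniteMeasure μ]
    (hΦ : Continuous (featureMap H : A → H)) (hκ : ∀ x : A, ‖featureMap H x‖ ≤ κ)
    {c : A × 𝒴 → ℝ} (hc : Measurable c) {C : ℝ} (hC : ∀ p, |c p| ≤ C) (h : H) :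
    ⟪∫ p, c p • featureMap H p.1 ∂μ, h⟫_ℝ = ∫ p, c p * h p.1 ∂μ := by
  rw [real_inner_comm, ← integral_inner (integrable_smul_featureMap hΦ hκ hc hC)]
  simp_rw [inner_smul_right, real_inner_comm (featureMap H _) h, featureMap_inner]

theorem integrable_riskGradient [IsFiniteMeasure μ] (hL : SmoothLoss L K M)
    (hΦ : Continuous (featureMap H : A → H)) (hκ : ∀ x : A, ‖featureMap H x‖ ≤ κ) (f : H) :
    Integrable (fun p => deriv (L p.2) (f p.1) • featureMap H p.1) μ :=
  integrable_smul_featureMap hΦ hκ (hL.measurable_deriv.comp (measurable_snd_coe_fst hΦ f))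
    fun _ => hL.abs_deriv_le _ _

theorem integrable_shiftedLoss [IsFiniteMeasure μ] (hL : SmoothLoss L K M)
    (hΦ : Continuous (featureMap H : A → H)) (hκ : ∀ x : A, ‖featureMap H x‖ ≤ κ) (f : H) :
    Integrable (fun p => shiftedLoss L p.2 (f p.1)) μ := by
  refine Integrable.of_bound
    (hL.measurable_shiftedLoss.comp (measurable_snd_coe_fst hΦ f)).aestronglyMeasurable
    (K * (κ * ‖f‖)) (Eventually.of_forall fun p => ?_)
  exact (hL.abs_shiftedLoss_le _ _).trans
    (mul_le_mul_of_nonneg_left (abs_apply_le hκ f _) K.2)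

theorem integrable_deriv_mul [IsFiniteMeasure μ] (hL : SmoothLoss L K M)
    (hΦ : Continuous (featureMap H : A → H)) (hκ : ∀ x : A, ‖featureMap H x‖ ≤ κ) (f h : H) :
    Integrable (fun p => deriv (L p.2) (f p.1) * h p.1) μ := by
  refine Integrable.of_bound ((hL.measurable_deriv.comp (measurable_snd_coe_fst hΦ f)).mul
    ((measurable_coe hΦ h).comp measurable_fst)).aestronglyMeasurable
    (K * (κ * ‖h‖)) (Eventually.of_forall fun p => ?_)
  rw [norm_mul]
  exact mul_le_mul (hL.abs_deriv_le _ _) (abs_apply_le hκ h _) (abs_nonneg _) K.2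

theorem inner_riskGradient [IsFiniteMeasure μ] (hL : SmoothLoss L K M)
    (hΦ : Continuous (featureMap H : A → H)) (hκ : ∀ x : A, ‖featureMap H x‖ ≤ κ) (f h : H) :
    ⟪riskGradient L μ f, h⟫_ℝ = ∫ p, deriv (L p.2) (f p.1) * h p.1 ∂μ :=
  inner_integral_smul_featureMap hΦ hκ
    (hL.measurable_deriv.comp (measurable_snd_coe_fst hΦ f)) (fun _ => hL.abs_deriv_le _ _) h

theorem norm_riskGradient_le [IsProbabilityMeasure μ] (hL : SmoothLoss L K M)
    (hκ : ∀ x : A, ‖featureMap H x‖ ≤ κ) (f : H) : ‖riskGradient L μ f‖ ≤ K * κ := by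
  have := norm_integral_le_of_norm_le_const (μ := μ)
    (f := fun p => deriv (L p.2) (f p.1) • featureMap H p.1) (C := K * κ)
    (Eventually.of_forall fun _ => by
      rw [norm_smul]
      exact mul_le_mul (hL.abs_deriv_le _ _) (hκ _) (norm_nonneg _) K.2)
  simpa [riskGradient] using this

/-- The integrand is `(L'(f) - L'(g))(f - g)`, whose factors have the same sign since `L'` is
nondecreasing. -/
theorem riskGradient_monotone [IsFiniteMeasure μ] (hL : SmoothLoss L K M)
    (hΦ : Continuous (featureMap H : A → H)) (hκ : ∀ x : A, ‖featureMap H x‖ ≤ κ) (f g : H) :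
    0 ≤ ⟪riskGradient L μ f - riskGradient L μ g, f - g⟫_ℝ := by
  rw [inner_sub_left, inner_riskGradient hL hΦ hκ, inner_riskGradient hL hΦ hκ,
    ← integral_sub (integrable_deriv_mul hL hΦ hκ _ _) (integrable_deriv_mul hL hΦ hκ _ _)]
  refine integral_nonneg fun p => ?_
  rw [← sub_mul, RKHS.coe_sub, Pi.sub_apply]
  rcases le_total (f p.1) (g p.1) with h | h
  · exact mul_nonneg_of_nonpos_of_nonpos (sub_nonpos.2 (hL.monotone_deriv _ h)) (sub_nonpos.2 h)
  · exact mul_nonneg (sub_nonneg.2 (hL.monotone_deriv _ h)) (sub_nonneg.2 h)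

theorem continuous_riskGradient [IsFiniteMeasure μ] (hL : SmoothLoss L K M)
    (hΦ : Continuous (featureMap H : A → H)) (hκ : ∀ x : A, ‖featureMap H x‖ ≤ κ) :
    Continuous (riskGradient L μ : H → H) := by
  refine continuous_of_dominated (bound := fun _ => K * κ)
    (fun f => (integrable_riskGradient hL hΦ hκ f).1) (fun f => Eventually.of_forall fun p => ?_)
    (integrable_const _) (Eventually.of_forall fun p => ?_)
  · rw [norm_smul]
    exact mul_le_mul (hL.abs_deriv_le _ _) (hκ _) (norm_nonneg _) K.2
  · exact ((hL.differentiable_deriv p.2).continuous.comp (RKHS.continuous_eval p.1)).smul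
      continuous_const

/-- The first order optimality condition for a support vector machine. -/
theorem IsSVM.stationary [IsFiniteMeasure μ] (hL : SmoothLoss L K M)
    (hΦ : Continuous (featureMap H : A → H)) (hκ : ∀ x : A, ‖featureMap H x‖ ≤ κ) {f : H}
    (hf : IsSVM L lam μ f) : (2 * lam) • f + riskGradient L μ f = 0 := by
  refine ext_inner_right ℝ fun h => ?_
  rw [inner_zero_left, inner_add_left, inner_riskGradient hL hΦ hκ, inner_smul_left]
  -- The risk is differentiated along the line `s ↦ f + s • h`, which has its minimum at `s = 0`; `K
  -- * (κ * ‖h‖)` dominates the derivative of the integrand.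
  have hd1 := (hasDerivAt_integral_of_dominated_loc_of_deriv_le (μ := μ) (x₀ := (0 : ℝ))
    (s := univ) (F := fun s p => shiftedLoss L p.2 ((f + s • h) p.1))
    (F' := fun s p => deriv (L p.2) ((f + s • h) p.1) * h p.1) (bound := fun _ => K * (κ * ‖h‖))
    univ_mem (Eventually.of_forall fun s => (integrable_shiftedLoss hL hΦ hκ _).1)
    (integrable_shiftedLoss hL hΦ hκ _) (integrable_deriv_mul hL hΦ hκ _ _).1
    (Eventually.of_forall fun p s _ => by
      rw [norm_mul]
      exact mul_le_mul (hL.abs_deriv_le _ _) (abs_apply_le hκ h _) (abs_nonneg _) K.2)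
    (integrable_const _)
    (Eventually.of_forall fun p s _ => by
      have h1 : HasDerivAt (fun s : ℝ => (f + s • h) p.1) (h p.1) s := by
        simpa using ((hasDerivAt_id s).mul_const (h p.1)).const_add (f p.1)
      exact (((hL.differentiable p.2 _).hasDerivAt.comp s h1).sub_const (L p.2 0)))).2
  have hd2 : HasDerivAt (fun s : ℝ => lam * ‖f + s • h‖ ^ 2)
      (lam * (2 * ⟪f + (0 : ℝ) • h, (1 : ℝ) • h⟫_ℝ)) 0 :=
    ((((hasDerivAt_id (0 : ℝ)).smul_const h).const_add f).norm_sq).const_mul lam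
  have hmin : IsLocalMin (fun s : ℝ => regRisk L lam μ (f + s • h)) 0 :=
    Eventually.of_forall fun s => by simpa using hf (f + s • h)
  have := hmin.hasDerivAt_eq_zero (hd1.add hd2)
  simp only [zero_smul, add_zero, one_smul] at this
  simp only [RCLike.conj_to_real]
  linarith

/-- Subtracting the optimality conditions turns monotonicity of the gradient into `0 ≤ -2λ‖f - g‖²`.
-/
theorem IsSVM.unique [IsFiniteMeasure μ] (hL : SmoothLoss L K M)
    (hΦ : Continuous (featureMap H : A → H)) (hκ : ∀ x : A, ‖featureMap H x‖ ≤ κ)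
    (hlam : 0 < lam) {f g : H} (hf : IsSVM L lam μ f) (hg : IsSVM L lam μ g) : f = g := by
  have h1 := hf.stationary hL hΦ hκ
  have h2 := hg.stationary hL hΦ hκ
  have h3 := riskGradient_monotone (μ := μ) hL hΦ hκ f g
  have h4 : riskGradient L μ f - riskGradient L μ g = -((2 * lam) • (f - g)) := by
    rw [eq_neg_of_add_eq_zero_right h1, eq_neg_of_add_eq_zero_right h2, smul_sub]; abel
  rw [h4, inner_neg_left, inner_smul_left, real_inner_self_eq_norm_sq] at h3
  simp only [RCLike.conj_to_real] at h3
  have h5 : ‖f - g‖ ^ 2 ≤ 0 := by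
    by_contra! hlt
    have : 0 < 2 * lam * ‖f - g‖ ^ 2 := by positivity
    linarith
  exact sub_eq_zero.1 (norm_eq_zero.1 (pow_eq_zero_iff two_ne_zero |>.1
    (le_antisymm h5 (sq_nonneg _))))

theorem abs_integral_shiftedLoss_sub_le [IsProbabilityMeasure μ] (hL : SmoothLoss L K M)
    (hΦ : Continuous (featureMap H : A → H)) (hκ : ∀ x : A, ‖featureMap H x‖ ≤ κ) (f g : H) :
    |∫ p, shiftedLoss L p.2 (f p.1) ∂μ - ∫ p, shiftedLoss L p.2 (g p.1) ∂μ|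
      ≤ K * κ * ‖f - g‖ := by
  rw [← integral_sub (integrable_shiftedLoss hL hΦ hκ f) (integrable_shiftedLoss hL hΦ hκ g)]
  have := norm_integral_le_of_norm_le_const (μ := μ)
    (f := fun p => shiftedLoss L p.2 (f p.1) - shiftedLoss L p.2 (g p.1))
    (C := K * κ * ‖f - g‖) (Eventually.of_forall fun p => by
      refine (hL.abs_shiftedLoss_sub_le _ _ _).trans ?_
      rw [mul_assoc]
      exact mul_le_mul_of_nonneg_left (by simpa using abs_apply_le hκ (f - g) p.1) K.2)
  simpa using this

/-- The loss contributes plain convexity; the parallelogram law for the penalty yields the gain `lam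
/ 4`. -/
theorem regRisk_midpoint_le [IsFiniteMeasure μ] (hL : SmoothLoss L K M)
    (hΦ : Continuous (featureMap H : A → H)) (hκ : ∀ x : A, ‖featureMap H x‖ ≤ κ) (f g : H) :
    regRisk L lam μ ((2⁻¹ : ℝ) • (f + g)) + lam / 4 * ‖f - g‖ ^ 2
      ≤ (regRisk L lam μ f + regRisk L lam μ g) / 2 := by
  have h1 : ∫ p, shiftedLoss L p.2 (((2⁻¹ : ℝ) • (f + g)) p.1) ∂μ
      ≤ ∫ p, (2⁻¹ * shiftedLoss L p.2 (f p.1) + 2⁻¹ * shiftedLoss L p.2 (g p.1)) ∂μ := by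
    refine integral_mono (integrable_shiftedLoss hL hΦ hκ _)
      (((integrable_shiftedLoss hL hΦ hκ f).const_mul _).add
        ((integrable_shiftedLoss hL hΦ hκ g).const_mul _)) fun p => ?_
    have := (hL.convex p.2).2 (mem_univ (f p.1)) (mem_univ (g p.1))
      (by norm_num : (0 : ℝ) ≤ 2⁻¹) (by norm_num : (0 : ℝ) ≤ 2⁻¹) (by norm_num)
    simp only [smul_eq_mul] at this
    simp only [shiftedLoss, RKHS.coe_smul, RKHS.coe_add, Pi.smul_apply, Pi.add_apply, smul_eq_mul,
      mul_add]
    linarith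
  rw [integral_add ((integrable_shiftedLoss hL hΦ hκ f).const_mul _)
    ((integrable_shiftedLoss hL hΦ hκ g).const_mul _), integral_const_mul,
    integral_const_mul] at h1
  have h2 := parallelogram_law_with_norm ℝ f g
  have h3 : ‖(2⁻¹ : ℝ) • (f + g)‖ ^ 2 = ‖f + g‖ ^ 2 / 4 := by
    rw [norm_smul, mul_pow]; norm_num; ring
  simp only [regRisk, h3]
  have h4 : lam * (‖f + g‖ ^ 2 + ‖f - g‖ ^ 2)
      = lam * (2 * (‖f‖ ^ 2 + ‖g‖ ^ 2)) := by rw [h2]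
  linarith

theorem exists_isSVM [IsProbabilityMeasure μ] (hL : SmoothLoss L K M)
    (hΦ : Continuous (featureMap H : A → H)) (hκ : ∀ x : A, ‖featureMap H x‖ ≤ κ)
    (hlam : 0 < lam) : ∃ f : H, IsSVM L lam μ f := by
  refine exists_forall_le_of_midpoint (c := lam / 4) (J := fun f : H => regRisk L lam μ f)
    ?_ ?_ (by positivity) (regRisk_midpoint_le hL hΦ hκ)
  · refine Continuous.add ?_ (by fun_prop)
    refine continuous_iff_continuousAt.2 fun f => ?_
    rw [ContinuousAt, tendsto_iff_norm_sub_tendsto_zero]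
    have h : Tendsto (fun g : H => K * κ * ‖g - f‖) (𝓝 f) (𝓝 (K * κ * ‖f - f‖)) :=
      Continuous.tendsto (by fun_prop) f
    rw [sub_self, norm_zero, mul_zero] at h
    exact squeeze_zero (fun _ => norm_nonneg _)
      (fun g => abs_integral_shiftedLoss_sub_le hL hΦ hκ g f) h
  -- The minimum of `t ↦ lam * t ^ 2 - K * κ * t`, found by completing the square.
  · refine ⟨-((K * κ) ^ 2 / (4 * lam)), ?_⟩
    rintro _ ⟨f, rfl⟩
    have h := abs_integral_shiftedLoss_sub_le (μ := μ) hL hΦ hκ f 0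
    simp only [RKHS.coe_zero, Pi.zero_apply, shiftedLoss, sub_self, integral_zero, sub_zero] at h
    have h1 := (abs_le.1 h).1
    have h2 : (K * κ) ^ 2 / (4 * lam) + lam * ‖f‖ ^ 2 - K * κ * ‖f‖
        = (K * κ - 2 * lam * ‖f‖) ^ 2 / (4 * lam) := by field_simp; ring
    have h3 : 0 ≤ (K * κ - 2 * lam * ‖f‖) ^ 2 / (4 * lam) := by positivity
    simp only [regRisk, shiftedLoss]
    linarith

end Local

end LocalSVM

end

/-! ### Linearization of the gradient and the influence function in the RKHS -/

noncomputable section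

namespace LocalSVM

open scoped InnerProductSpace
open InnerProductSpace (rankOne)

section Derivative

set_option linter.unusedSectionVars false

variable {A 𝒴 H : Type*} [TopologicalSpace A] [SecondCountableTopology A] [MeasurableSpace A]
  [OpensMeasurableSpace A] [MeasurableSpace 𝒴] [NormedAddCommGroup H] [InnerProductSpace ℝ H]
  [CompleteSpace H] [RKHS ℝ H A ℝ] {L : 𝒴 → ℝ → ℝ} {K M : ℝ≥0} {lam κ : ℝ}
  {μ ν : Measure (A × 𝒴)}

/-- The derivative `h ↦ ∫ L''(y, f(x)) h(x) k(·, x) dμ(x, y)` of the risk gradient at `f`. -/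
def riskHessian (L : 𝒴 → ℝ → ℝ) (μ : Measure (A × 𝒴)) (f : H) : H →L[ℝ] H :=
  ∫ p, deriv (deriv (L p.2)) (f p.1) • rankOne ℝ (featureMap H p.1) (featureMap H p.1) ∂μ

theorem integrable_riskHessian [IsFiniteMeasure μ] (hL : SmoothLoss L K M)
    (hΦ : Continuous (featureMap H : A → H)) (hκ : ∀ x : A, ‖featureMap H x‖ ≤ κ) (f : H) :
    Integrable (fun p => deriv (deriv (L p.2)) (f p.1) •
      rankOne ℝ (featureMap H p.1) (featureMap H p.1)) μ := by
  have hR : Continuous fun x : A => rankOne ℝ (featureMap H x) (featureMap H x) :=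
    ((rankOne ℝ : H →L[ℝ] _).continuous.comp hΦ).clm_apply hΦ
  refine Integrable.of_bound
    ((hL.measurable_deriv2.comp (measurable_snd_coe_fst hΦ f)).aestronglyMeasurable.smul
      (hR.stronglyMeasurable.comp_measurable measurable_fst).aestronglyMeasurable)
    (M * (κ * κ)) (Eventually.of_forall fun p => ?_)
  rw [norm_smul, InnerProductSpace.norm_rankOne]
  have hκ0 : 0 ≤ κ := (norm_nonneg _).trans (hκ p.1)
  exact mul_le_mul (hL.abs_deriv2_le _ _) (mul_le_mul (hκ _) (hκ _) (norm_nonneg _) hκ0)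
    (by positivity) M.2

theorem riskHessian_apply [IsFiniteMeasure μ] (hL : SmoothLoss L K M)
    (hΦ : Continuous (featureMap H : A → H)) (hκ : ∀ x : A, ‖featureMap H x‖ ≤ κ) (f h : H) :
    riskHessian L μ f h
      = ∫ p, (deriv (deriv (L p.2)) (f p.1) * h p.1) • featureMap H p.1 ∂μ := by
  rw [riskHessian, ContinuousLinearMap.integral_apply (integrable_riskHessian hL hΦ hκ f)]
  refine integral_congr_ae (Eventually.of_forall fun p => ?_)
  simp only [smul_apply, InnerProductSpace.rankOne_apply, featureMap_inner,
    smul_smul]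

theorem measurable_deriv2_mul (hL : SmoothLoss L K M)
    (hΦ : Continuous (featureMap H : A → H)) (f h : H) :
    Measurable fun p : A × 𝒴 => deriv (deriv (L p.2)) (f p.1) * h p.1 :=
  (hL.measurable_deriv2.comp (measurable_snd_coe_fst hΦ f)).mul
    ((measurable_coe hΦ h).comp measurable_fst)

theorem abs_deriv2_mul_le (hL : SmoothLoss L K M) (hκ : ∀ x : A, ‖featureMap H x‖ ≤ κ)
    (f h : H) (p : A × 𝒴) :
    |deriv (deriv (L p.2)) (f p.1) * h p.1| ≤ M * (κ * ‖h‖) := by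
  rw [abs_mul]
  exact mul_le_mul (hL.abs_deriv2_le _ _) (abs_apply_le hκ h _) (abs_nonneg _) M.2

theorem riskHessian_nonneg [IsFiniteMeasure μ] (hL : SmoothLoss L K M)
    (hΦ : Continuous (featureMap H : A → H)) (hκ : ∀ x : A, ‖featureMap H x‖ ≤ κ) (f h : H) :
    0 ≤ ⟪riskHessian L μ f h, h⟫_ℝ := by
  rw [riskHessian_apply hL hΦ hκ, inner_integral_smul_featureMap hΦ hκ
    (measurable_deriv2_mul hL hΦ f h) (abs_deriv2_mul_le hL hκ f h)]
  refine integral_nonneg fun p => ?_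
  rw [mul_assoc]
  exact mul_nonneg (hL.deriv2_nonneg _ _) (mul_self_nonneg _)

/-- The regularized Hessian `2 lam + riskHessian` is invertible. -/
theorem exists_equiv_regularized_hessian [IsFiniteMeasure μ] (hL : SmoothLoss L K M)
    (hΦ : Continuous (featureMap H : A → H)) (hκ : ∀ x : A, ‖featureMap H x‖ ≤ κ)
    (hlam : 0 < lam) (f : H) :
    ∃ e : H ≃L[ℝ] H, ∀ h, e h = (2 * lam) • h + riskHessian L μ f h := by
  set T : H →L[ℝ] H := (2 * lam) • ContinuousLinearMap.id ℝ H + riskHessian L μ f with hT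
  -- Lax–Milgram: the Hessian is positive semidefinite, so the form of `T` is coercive with constant
  -- `2 * lam`.
  have hcoer : IsCoercive ((innerSL ℝ).comp T : H →L[ℝ] H →L[ℝ] ℝ) := by
    refine ⟨2 * lam, by positivity, fun h => ?_⟩
    have h1 : ((innerSL ℝ).comp T : H →L[ℝ] H →L[ℝ] ℝ) h h
        = 2 * lam * (‖h‖ * ‖h‖) + ⟪riskHessian L μ f h, h⟫_ℝ := by
      rw [ContinuousLinearMap.comp_apply, innerSL_apply_apply, hT, add_apply,
        inner_add_left, smul_apply, ContinuousLinearMap.id_apply,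
        real_inner_smul_left, real_inner_self_eq_norm_mul_norm]
    rw [h1, mul_assoc]
    have := riskHessian_nonneg (μ := μ) hL hΦ hκ f h
    linarith
  refine ⟨hcoer.continuousLinearEquivOfBilin, fun h => ?_⟩
  refine ext_inner_right ℝ fun v => ?_
  rw [IsCoercive.continuousLinearEquivOfBilin_apply, ContinuousLinearMap.comp_apply,
    innerSL_apply_apply, hT, add_apply, smul_apply, ContinuousLinearMap.id_apply]

/-- Differentiability of the risk gradient along a curve `F` with `F ε - f = O(ε)`. -/
theorem tendsto_riskGradient_remainder [IsFiniteMeasure μ] (hL : SmoothLoss L K M)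
    (hΦ : Continuous (featureMap H : A → H)) (hκ : ∀ x : A, ‖featureMap H x‖ ≤ κ) {F : ℝ → H}
    {f : H} {C : ℝ} (hF : ∀ᶠ ε in 𝓝[>] (0 : ℝ), ‖F ε - f‖ ≤ C * ε) :
    Tendsto (fun ε : ℝ => ε⁻¹ • (riskGradient L μ (F ε) - riskGradient L μ f
      - riskHessian L μ f (F ε - f))) (𝓝[>] 0) (𝓝 0) := by
  have hpos : ∀ᶠ ε in 𝓝[>] (0 : ℝ), 0 < ε := self_mem_nhdsWithin
  -- The first order Taylor remainder of `L'` at each point. It is `o(ε)` only pointwise, so the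
  -- limit is taken by dominated convergence.
  set r : ℝ → A × 𝒴 → ℝ := fun ε p => deriv (L p.2) (F ε p.1) - deriv (L p.2) (f p.1)
    - deriv (deriv (L p.2)) (f p.1) * (F ε - f) p.1 with hr
  have hrm : ∀ ε, Measurable (r ε) := fun ε =>
    ((hL.measurable_deriv.comp (measurable_snd_coe_fst hΦ (F ε))).sub
      (hL.measurable_deriv.comp (measurable_snd_coe_fst hΦ f))).sub
      (measurable_deriv2_mul hL hΦ f _)
  have heq : ∀ ε : ℝ, ε⁻¹ • (riskGradient L μ (F ε) - riskGradient L μ f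
      - riskHessian L μ f (F ε - f)) = ∫ p, (ε⁻¹ * r ε p) • featureMap H p.1 ∂μ := by
    intro ε
    have hi := fun g => integrable_riskGradient (μ := μ) hL hΦ hκ g
    have hi2 : Integrable (fun p => deriv (L p.2) (F ε p.1) • featureMap H p.1
        - deriv (L p.2) (f p.1) • featureMap H p.1) μ := (hi (F ε)).sub (hi f)
    simp_rw [mul_smul, hr, sub_smul]
    rw [integral_smul, riskHessian_apply hL hΦ hκ, riskGradient, riskGradient,
      integral_sub hi2 (integrable_smul_featureMap hΦ hκ
        (measurable_deriv2_mul hL hΦ f _) (abs_deriv2_mul_le hL hκ f _)),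
      integral_sub (hi (F ε)) (hi f)]
  simp_rw [heq]
  rw [← integral_zero (A × 𝒴) H (μ := μ)]
  refine tendsto_integral_filter_of_dominated_convergence (fun _ => 2 * M * κ * C * κ)
    (Eventually.of_forall fun ε =>
      aestronglyMeasurable_smul_featureMap hΦ ((hrm ε).const_mul ε⁻¹)) ?_ (integrable_const _) ?_
  · filter_upwards [hF, hpos] with ε hε hε0
    refine Eventually.of_forall fun p => ?_
    have hκ0 : 0 ≤ κ := (norm_nonneg _).trans (hκ p.1)
    have h0 : |(F ε - f) p.1| ≤ κ * (C * ε) :=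
      (abs_apply_le hκ _ _).trans (mul_le_mul_of_nonneg_left hε hκ0)
    -- One `M` from the mean value bound on the increment of `L'`, one from the linear term.
    have h1 : |r ε p| ≤ 2 * M * |(F ε - f) p.1| := by
      have ha := hL.abs_deriv_sub_le p.2 (F ε p.1) (f p.1)
      have hb : |deriv (deriv (L p.2)) (f p.1) * (F ε - f) p.1| ≤ M * |(F ε - f) p.1| := by
        rw [abs_mul]
        exact mul_le_mul_of_nonneg_right (hL.abs_deriv2_le _ _) (abs_nonneg _)
      have hc : (F ε - f) p.1 = F ε p.1 - f p.1 := by simp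
      rw [← hc] at ha
      exact (abs_sub _ _).trans (by linarith)
    rw [norm_smul, norm_mul, norm_inv, Real.norm_eq_abs, Real.norm_eq_abs, abs_of_pos hε0]
    have h2 : ε⁻¹ * |r ε p| ≤ 2 * M * κ * C := by
      rw [inv_mul_le_iff₀ hε0]
      have : 2 * M * |(F ε - f) p.1| ≤ 2 * M * (κ * (C * ε)) := by gcongr
      linarith
    exact mul_le_mul h2 (hκ _) (norm_nonneg _) ((by positivity : 0 ≤ ε⁻¹ * |r ε p|).trans h2)
  · refine Eventually.of_forall fun p => ?_
    have hκ0 : 0 ≤ κ := (norm_nonneg _).trans (hκ p.1)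
    have hO : (fun ε => (F ε - f) p.1) =O[𝓝[>] 0] fun ε : ℝ => ε := by
      refine Asymptotics.IsBigO.of_bound (κ * C) ?_
      filter_upwards [hF, hpos] with ε hε hε0
      rw [Real.norm_eq_abs, Real.norm_eq_abs, abs_of_pos hε0, mul_assoc]
      exact (abs_apply_le hκ _ _).trans (mul_le_mul_of_nonneg_left hε hκ0)
    have ht : Tendsto (fun ε => (F ε - f) p.1) (𝓝[>] 0) (𝓝 0) :=
      hO.trans_tendsto (tendsto_id.mono_left nhdsWithin_le_nhds)
    have hd := (hasDerivAt_iff_isLittleO_nhds_zero.1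
      (hL.differentiable_deriv p.2 (f p.1)).hasDerivAt).comp_tendsto ht
    have h := (hd.trans_isBigO hO).tendsto_div_nhds_zero
    have h' : Tendsto (fun ε : ℝ => ε⁻¹ * r ε p) (𝓝[>] 0) (𝓝 0) := by
      refine h.congr fun ε => ?_
      simp only [hr, Function.comp, RKHS.coe_sub, Pi.sub_apply, smul_eq_mul, add_sub_cancel]
      ring
    simpa using h'.smul_const (featureMap H p.1)

theorem riskGradient_contaminate [IsFiniteMeasure μ] [IsFiniteMeasure ν] (hL : SmoothLoss L K M)
    (hΦ : Continuous (featureMap H : A → H)) (hκ : ∀ x : A, ‖featureMap H x‖ ≤ κ) {ε : ℝ}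
    (hε : ε ∈ Icc (0 : ℝ) 1) (f : H) :
    riskGradient L (ENNReal.ofReal (1 - ε) • μ + ENNReal.ofReal ε • ν) f
      = riskGradient L μ f + ε • (riskGradient L ν f - riskGradient L μ f) := by
  rw [riskGradient, integral_add_measure
    ((integrable_riskGradient hL hΦ hκ f).smul_measure ENNReal.ofReal_ne_top)
    ((integrable_riskGradient hL hΦ hκ f).smul_measure ENNReal.ofReal_ne_top),
    integral_smul_measure, integral_smul_measure, ENNReal.toReal_ofReal (sub_nonneg.2 hε.2),
    ENNReal.toReal_ofReal hε.1]
  simp only [riskGradient, sub_smul, smul_sub, one_smul]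
  abel

/-- The support vector machine is Lipschitz in the contamination. -/
theorem norm_contaminated_sub_le [IsProbabilityMeasure μ] [IsProbabilityMeasure ν]
    (hL : SmoothLoss L K M) (hΦ : Continuous (featureMap H : A → H))
    (hκ : ∀ x : A, ‖featureMap H x‖ ≤ κ) (hlam : 0 < lam) {f g : H}
    (hf : IsSVM L lam μ f) {ε : ℝ} (hε : ε ∈ Icc (0 : ℝ) 1)
    (hg : IsSVM L lam (ENNReal.ofReal (1 - ε) • μ + ENNReal.ofReal ε • ν) g) :
    ‖g - f‖ ≤ K * κ * lam⁻¹ * ε := by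
  have hfin : IsFiniteMeasure (ENNReal.ofReal (1 - ε) • μ + ENNReal.ofReal ε • ν) := by
    have := μ.smul_finite (c := ENNReal.ofReal (1 - ε)) ENNReal.ofReal_ne_top
    have := ν.smul_finite (c := ENNReal.ofReal ε) ENNReal.ofReal_ne_top
    infer_instance
  have h1 := hf.stationary hL hΦ hκ
  have h2 := hg.stationary hL hΦ hκ
  rw [riskGradient_contaminate hL hΦ hκ hε] at h2
  set a := riskGradient L ν g - riskGradient L μ g with ha
  have h3 : (2 * lam) • (g - f)
      = -(riskGradient L μ g - riskGradient L μ f) - ε • a := by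
    rw [smul_sub, eq_neg_of_add_eq_zero_left h1, eq_neg_of_add_eq_zero_left h2]; abel
  -- In the pairing with `g - f` the increment of the gradient has a favourable sign by
  -- monotonicity; only the term of size `ε * ‖a‖` has to be estimated.
  have h4 : 2 * lam * (‖g - f‖ * ‖g - f‖)
      = -⟪riskGradient L μ g - riskGradient L μ f, g - f⟫_ℝ - ε * ⟪a, g - f⟫_ℝ := by
    rw [← real_inner_self_eq_norm_mul_norm, ← real_inner_smul_left, h3, inner_sub_left,
      inner_neg_left, real_inner_smul_left]
  have h5 := riskGradient_monotone (μ := μ) hL hΦ hκ g f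
  have h6 : ‖a‖ ≤ 2 * (K * κ) := by
    have := norm_sub_le (riskGradient L ν g) (riskGradient L μ g)
    have := norm_riskGradient_le (μ := μ) hL hκ g
    have := norm_riskGradient_le (μ := ν) hL hκ g
    rw [ha]; linarith
  have h7 : -⟪a, g - f⟫_ℝ ≤ 2 * (K * κ) * ‖g - f‖ :=
    (neg_le_abs _).trans ((abs_real_inner_le_norm _ _).trans (by gcongr))
  have h8 : ε * -⟪a, g - f⟫_ℝ ≤ ε * (2 * (K * κ) * ‖g - f‖) :=
    mul_le_mul_of_nonneg_left h7 hε.1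
  have h9 : lam * ‖g - f‖ * ‖g - f‖ ≤ K * κ * ε * ‖g - f‖ := by linarith
  have hKκ : 0 ≤ K * κ := (norm_nonneg _).trans (norm_riskGradient_le (μ := μ) hL hκ f)
  rcases (norm_nonneg (g - f)).eq_or_lt with h0 | h0
  · rw [← h0]
    exact mul_nonneg (mul_nonneg hKκ (inv_nonneg.2 hlam.le)) hε.1
  · have h10 := le_of_mul_le_mul_right h9 h0
    have h11 : K * κ * lam⁻¹ * ε = (K * κ * ε) / lam := by field_simp
    rw [h11, le_div_iff₀ hlam]
    linarith

/-- Existence and boundedness of the influence function of a support vector machine in the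
direction of a contaminating distribution. -/
theorem exists_influence [IsProbabilityMeasure μ] [IsProbabilityMeasure ν]
    (hL : SmoothLoss L K M) (hΦ : Continuous (featureMap H : A → H))
    (hκ : ∀ x : A, ‖featureMap H x‖ ≤ κ) (hlam : 0 < lam) {f : H} (hf : IsSVM L lam μ f)
    {F : ℝ → H} (hF : ∀ ε ∈ Icc (0 : ℝ) 1,
      IsSVM L lam (ENNReal.ofReal (1 - ε) • μ + ENNReal.ofReal ε • ν) (F ε)) :
    ∃ u : H, ‖u‖ ≤ K * κ * lam⁻¹ ∧
      Tendsto (fun ε : ℝ => ε⁻¹ • (F ε - f)) (𝓝[>] 0) (𝓝 u) := by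
  have hmem : ∀ᶠ ε in 𝓝[>] (0 : ℝ), ε ∈ Ioo (0 : ℝ) 1 := Ioo_mem_nhdsGT one_pos
  have hlip : ∀ᶠ ε in 𝓝[>] (0 : ℝ), ‖F ε - f‖ ≤ K * κ * lam⁻¹ * ε := by
    filter_upwards [hmem] with ε hε
    have hε' := Ioo_subset_Icc_self hε
    exact norm_contaminated_sub_le hL hΦ hκ hlam hf hε' (hF ε hε')
  have hFt : Tendsto F (𝓝[>] 0) (𝓝 f) := by
    rw [tendsto_iff_norm_sub_tendsto_zero]
    refine squeeze_zero' (Eventually.of_forall fun _ => norm_nonneg _) hlip ?_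
    have h : Tendsto (fun ε : ℝ => K * κ * lam⁻¹ * ε) (𝓝 0) (𝓝 (K * κ * lam⁻¹ * 0)) :=
      tendsto_id.const_mul _
    rw [mul_zero] at h
    exact h.mono_left nhdsWithin_le_nhds
  obtain ⟨e, he⟩ := exists_equiv_regularized_hessian (μ := μ) hL hΦ hκ hlam f
  -- The argument of `e.symm` is `e (ε⁻¹ • (F ε - f))`, rewritten by means of the two optimality
  -- conditions.
  have hlim : Tendsto (fun ε : ℝ => e.symm (-(ε⁻¹ • (riskGradient L μ (F ε) - riskGradient L μ f
      - riskHessian L μ f (F ε - f))) - (riskGradient L ν (F ε) - riskGradient L μ (F ε))))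
      (𝓝[>] 0) (𝓝 (e.symm (-0 - (riskGradient L ν f - riskGradient L μ f)))) :=
    (e.symm.continuous.tendsto _).comp
      ((tendsto_riskGradient_remainder hL hΦ hκ hlip).neg.sub
        ((((continuous_riskGradient hL hΦ hκ).tendsto f).comp hFt).sub
          (((continuous_riskGradient hL hΦ hκ).tendsto f).comp hFt)))
  have hu : Tendsto (fun ε : ℝ => ε⁻¹ • (F ε - f)) (𝓝[>] 0)
      (𝓝 (e.symm (-0 - (riskGradient L ν f - riskGradient L μ f)))) := by
    refine hlim.congr' ?_
    filter_upwards [hmem] with ε hε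
    have hε' := Ioo_subset_Icc_self hε
    have hfin : IsFiniteMeasure (ENNReal.ofReal (1 - ε) • μ + ENNReal.ofReal ε • ν) := by
      have := μ.smul_finite (c := ENNReal.ofReal (1 - ε)) ENNReal.ofReal_ne_top
      have := ν.smul_finite (c := ENNReal.ofReal ε) ENNReal.ofReal_ne_top
      infer_instance
    have h1 := hf.stationary hL hΦ hκ
    have h2 := (hF ε hε').stationary hL hΦ hκ
    rw [riskGradient_contaminate hL hΦ hκ hε'] at h2
    rw [ContinuousLinearEquiv.symm_apply_eq, map_smul, he, smul_sub (2 * lam),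
      eq_neg_of_add_eq_zero_left h1, eq_neg_of_add_eq_zero_left h2]
    have h3 : riskGradient L ν (F ε) - riskGradient L μ (F ε)
        = ε⁻¹ • ε • (riskGradient L ν (F ε) - riskGradient L μ (F ε)) :=
      (inv_smul_smul₀ hε.1.ne' _).symm
    rw [h3, ← smul_neg, ← smul_sub]
    congr 1
    rw [← h3]
    abel
  refine ⟨_, le_of_tendsto hu.norm ?_, hu⟩
  filter_upwards [hlip, hmem] with ε hε hε0
  rw [norm_smul, norm_inv, Real.norm_eq_abs, abs_of_pos hε0.1, inv_mul_le_iff₀ hε0.1]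
  linarith

end Derivative

end LocalSVM

end

/-! ### Regional measures and local predictors -/

noncomputable section

namespace LocalSVM

section Regional

variable {X 𝒴 : Type*} [MeasurableSpace X] [MeasurableSpace 𝒴] {P Q : Measure (X × 𝒴)} {A : Set X}

theorem fst_eq_prod_univ (hA : MeasurableSet A) : P.fst A = P (A ×ˢ univ) := by
  rw [Measure.fst_apply hA, prod_univ]

theorem isProbabilityMeasure_regional [IsFiniteMeasure P] (hA : MeasurableSet A)
    (hP : P.fst A ≠ 0) : IsProbabilityMeasure (regional P A) := by
  rw [fst_eq_prod_univ hA] at hP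
  have hemb : MeasurableEmbedding (Prod.map Subtype.val id : A × 𝒴 → X × 𝒴) :=
    (MeasurableEmbedding.subtype_coe hA).prodMap MeasurableEmbedding.id
  refine ⟨?_⟩
  rw [regional, hemb.comap_apply, image_univ, range_prodMap, Subtype.range_coe, range_id,
    ProbabilityTheory.cond_apply (hA.prod MeasurableSet.univ), inter_self]
  exact ENNReal.inv_mul_cancel hP (measure_ne_top _ _)

theorem fst_ne_zero_of_regional_ne_zero (hA : MeasurableSet A) (hP : regional P A ≠ 0) :
    P.fst A ≠ 0 := by
  intro h
  rw [fst_eq_prod_univ hA] at h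
  apply hP
  rw [regional, ProbabilityTheory.cond_eq_zero_of_meas_eq_zero h, Measure.comap_zero]

end Regional

theorem localPredictor_eq_coe {A 𝒴 H : Type*} [MeasurableSpace A] [MeasurableSpace 𝒴]
    [NormedAddCommGroup H] [InnerProductSpace ℝ H] [RKHS ℝ H A ℝ] {L : 𝒴 → ℝ → ℝ} {lam : ℝ}
    {g : Measure (A × 𝒴) → A → ℝ} {μ : Measure (A × 𝒴)} [hμ : IsProbabilityMeasure μ]
    (hex : ∃ f : H, IsSVM L lam μ f) :
    ∃ f : H, IsSVM L lam μ f ∧ localPredictor H L lam g μ = f :=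
  ⟨_, Classical.epsilon_spec hex, by rw [localPredictor, if_pos hμ]⟩

theorem isProbabilityMeasure_contaminate {Ω : Type*} [MeasurableSpace Ω] {μ ν : Measure Ω}
    [IsProbabilityMeasure μ] [IsProbabilityMeasure ν] {ε : ℝ} (hε : ε ∈ Icc (0 : ℝ) 1) :
    IsProbabilityMeasure (ENNReal.ofReal (1 - ε) • μ + ENNReal.ofReal ε • ν) := by
  refine ⟨?_⟩
  rw [Measure.add_apply, Measure.smul_apply, Measure.smul_apply, measure_univ, measure_univ,
    smul_eq_mul, smul_eq_mul, mul_one, mul_one, ← ENNReal.ofReal_add (sub_nonneg.2 hε.2) hε.1,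
    sub_add_cancel, ENNReal.ofReal_one]

section LocalInfluence

set_option linter.unusedSectionVars false

variable {X 𝒴 : Type*} [MetricSpace X] [SecondCountableTopology X] [MeasurableSpace X]
  [BorelSpace X] [MeasurableSpace 𝒴] {P Q : Measure (X × 𝒴)} {A : Set X} {H : Type*}
  [NormedAddCommGroup H] [InnerProductSpace ℝ H] [CompleteSpace H] [RKHS ℝ H A ℝ]
  {L : 𝒴 → ℝ → ℝ} {K M : ℝ≥0} {lam : ℝ} {g : Measure (A × 𝒴) → A → ℝ}

theorem measurable_localPredictor (hkc : ContinuousKernel (A := A) H)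
    (hg : ∀ μ, Measurable (g μ)) (μ : Measure (A × 𝒴)) :
    Measurable (localPredictor H L lam g μ) := by
  rw [localPredictor]
  split_ifs
  · exact measurable_coe (continuous_featureMap H hkc) _
  · exact hg μ

/-- The influence function of a local predictor on a region of positive mass. -/
theorem exists_local_influence [IsProbabilityMeasure P] [IsProbabilityMeasure Q]
    (hA : MeasurableSet A) (hL : SmoothLoss L K M) (hkb : BoundedKernel (A := A) H)
    (hkc : ContinuousKernel (A := A) H) (hlam : 0 < lam) (hP : P.fst A ≠ 0) :
    ∃ (f : H) (F : ℝ → H) (u : H), localPredictor H L lam g (regional P A) = f ∧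
      (∀ ε ∈ Icc (0 : ℝ) 1, localPredictor H L lam g (contaminated P Q A ε) = F ε) ∧
      ‖u‖ ≤ K * kernelSup (A := A) H * lam⁻¹ ∧
      Tendsto (fun ε : ℝ => ε⁻¹ • (F ε - f)) (𝓝[>] 0) (𝓝 u) := by
  have hΦ := continuous_featureMap H hkc
  have hκ := norm_featureMap_le H hkb
  have hPp := isProbabilityMeasure_regional hA hP
  obtain ⟨f, hf, hfe⟩ := localPredictor_eq_coe (g := g)
    (exists_isSVM (H := H) (μ := regional P A) hL hΦ hκ hlam)
  by_cases hQ : regional Q A = 0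
  -- If `Q` does not charge the region, nothing is contaminated: the curve is constant and its
  -- influence is zero.
  · refine ⟨f, fun _ => f, 0, hfe, fun ε _ => ?_, ?_, by simp⟩
    · rw [contaminated, if_neg (not_not.2 hQ), hfe]
    · rw [norm_zero]
      exact mul_nonneg (mul_nonneg K.2 (kernelSup_nonneg H)) (inv_nonneg.2 hlam.le)
  · have hQp := isProbabilityMeasure_regional hA (fst_ne_zero_of_regional_ne_zero hA hQ)
    have hex : ∀ ε : ℝ, ∃ F : H, ε ∈ Icc (0 : ℝ) 1 → IsSVM L lam
        (ENNReal.ofReal (1 - ε) • regional P A + ENNReal.ofReal ε • regional Q A) F ∧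
        localPredictor H L lam g (contaminated P Q A ε) = F := by
      intro ε
      by_cases hε : ε ∈ Icc (0 : ℝ) 1
      · have hp := isProbabilityMeasure_contaminate (μ := regional P A) (ν := regional Q A) hε
        obtain ⟨F, hF, hFe⟩ := localPredictor_eq_coe (g := g) (exists_isSVM (H := H) (μ :=
          ENNReal.ofReal (1 - ε) • regional P A + ENNReal.ofReal ε • regional Q A) hL hΦ hκ hlam)
        refine ⟨F, fun _ => ⟨hF, ?_⟩⟩
        rw [contaminated, if_pos hQ, hFe]
      · exact ⟨0, fun h => absurd h hε⟩
    choose F hF using hex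
    obtain ⟨u, hu, hut⟩ := exists_influence hL hΦ hκ hlam hf fun ε hε => (hF ε hε).1
    exact ⟨f, F, u, hfe, fun ε hε => (hF ε hε).2, hu, hut⟩

end LocalInfluence

/-! ### Composition of local functions -/

section Compose

variable {X : Type*} {B : ℕ} {R : Fin B → Set X} {w : Fin B → X → ℝ}

open Classical in
/-- The function `x ↦ ∑_b w_b(x) V_b(x)` composed of functions on the regions. -/
def compose (R : Fin B → Set X) (w : Fin B → X → ℝ) (V : ∀ b, R b → ℝ) (x : X) : ℝ :=
  ∑ b, w b x * (if hx : x ∈ R b then V b ⟨x, hx⟩ else 0)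

theorem compose_sub_div_sub (V V' U : ∀ b, R b → ℝ) (ε : ℝ) (x : X) :
    (compose R w V x - compose R w V' x) / ε - compose R w U x
      = compose R w (fun b z => (V b z - V' b z) / ε - U b z) x := by
  rw [compose, compose, compose, compose, ← Finset.sum_sub_distrib, Finset.sum_div,
    ← Finset.sum_sub_distrib]
  refine Finset.sum_congr rfl fun b _ => ?_
  split_ifs <;> ring

variable [MeasurableSpace X]

theorem measurable_compose (hR : ∀ b, MeasurableSet (R b)) (hw : ∀ b, Measurable (w b))
    {V : ∀ b, R b → ℝ} (hV : ∀ b, Measurable (V b)) : Measurable (compose R w V) := by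
  classical
  refine Finset.measurable_fun_sum _ fun b _ => (hw b).mul ?_
  exact Measurable.dite (hV b) measurable_const (hR b)

/-- There are finitely many regions, so almost every point avoids all null ones; hence `V b` needs a
bound only where the region has positive mass. -/
theorem ae_abs_compose_le {μ : Measure X} (hw : ∀ b x, w b x ∈ Icc (0 : ℝ) 1)
    {V : ∀ b, R b → ℝ} {c : Fin B → ℝ} (hc : ∀ b, 0 ≤ c b)
    (hV : ∀ b, μ (R b) ≠ 0 → ∀ x, |V b x| ≤ c b) :
    ∀ᵐ x ∂μ, |compose R w V x| ≤ ∑ b, (⨆ x : R b, w b x) * c b := by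
  have h : ∀ᵐ x ∂μ, ∀ b, x ∈ R b → μ (R b) ≠ 0 := by
    refine ae_all_iff.2 fun b => ?_
    by_cases hb : μ (R b) = 0
    · filter_upwards [measure_eq_zero_iff_ae_notMem.1 hb] with x hx hx'
      exact absurd hx' hx
    · exact Eventually.of_forall fun _ _ => hb
  have hs : ∀ b, 0 ≤ ⨆ x : R b, w b x := fun b => Real.iSup_nonneg fun x => (hw b x).1
  filter_upwards [h] with x hx
  refine (Finset.abs_sum_le_sum_abs _ _).trans (Finset.sum_le_sum fun b _ => ?_)
  split_ifs with hxb
  · rw [abs_mul, abs_of_nonneg (hw b x).1]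
    have hle : w b x ≤ ⨆ x : R b, w b x :=
      le_ciSup (f := fun x : R b => w b x) ⟨1, by rintro _ ⟨z, rfl⟩; exact (hw b z).2⟩ ⟨x, hxb⟩
    exact mul_le_mul hle (hV b (hx b hxb) _) (abs_nonneg _) (hs b)
  · rw [mul_zero, abs_zero]
    exact mul_nonneg (hs b) (hc b)

end Compose

theorem eLpNorm_top_le_ofReal {X : Type*} [MeasurableSpace X] {μ : Measure X} {f : X → ℝ} {C : ℝ}
    (h : ∀ᵐ x ∂μ, |f x| ≤ C) : eLpNorm f ∞ μ ≤ ENNReal.ofReal C := by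
  simpa using eLpNorm_le_of_ae_bound (p := ∞) h

end LocalSVM

end

/-! ### The main theorem -/

open LocalSVM

theorem corollary3p5
    -- the input space and the output space
    {X : Type*} [MetricSpace X] [TopologicalSpace.SeparableSpace X] [MeasurableSpace X]
    [BorelSpace X] (Y : Set ℝ) (hY : IsClosed Y)
    -- the regions, which are complete (and separable, as subsets of `X`)
    {B : ℕ} (R : Fin B → Set X) (hR : ∀ b, IsComplete (R b))
    -- the reproducing kernel Hilbert spaces on the regions
    (H : Fin B → Type*) [∀ b, NormedAddCommGroup (H b)] [∀ b, InnerProductSpace ℝ (H b)]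
    [∀ b, CompleteSpace (H b)] [∀ b, RKHS ℝ (H b) (R b) ℝ]
    (hkb : ∀ b, LocalSVM.BoundedKernel (H b)) (hkc : ∀ b, LocalSVM.ContinuousKernel (H b))
    -- the weights
    (w : Fin B → X → ℝ) (hwm : ∀ b, Measurable (w b)) (hw01 : ∀ b x, w b x ∈ Icc (0 : ℝ) 1)
    (hw1 : ∀ x, ∑ b, w b x = 1) (hw2 : ∀ b, ∀ x ∉ R b, w b x = 0)
    -- the regularization parameters
    (lam : Fin B → ℝ) (hlam : ∀ b, 0 < lam b)
    -- the loss function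
    (L : Y → ℝ → ℝ) (hLm : Measurable fun p : Y × ℝ => L p.1 p.2) (hL0 : ∀ y t, 0 ≤ L y t)
    (hLconv : ∀ y, ConvexOn ℝ univ (L y))
    (K : ℝ≥0) (hLip : ∀ y, LipschitzWith K (L y))
    (hLC2 : ∀ y, ContDiff ℝ 2 (L y))
    (hL'b : BddAbove (range fun p : Y × ℝ => |deriv (L p.1) p.2|))
    (hL'pos : 0 < ⨆ p : Y × ℝ, |deriv (L p.1) p.2|)
    (hL''b : BddAbove (range fun p : Y × ℝ => |deriv (deriv (L p.1)) p.2|))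
    -- the arbitrary measurable functions used where the regional measure is not a probability
    (g : ∀ b, Measure (R b × Y) → R b → ℝ) (hg : ∀ b μ, Measurable (g b μ)) :
    -- the local SVMs are well defined
    (∀ (b : Fin B) (μ : Measure (R b × Y)), IsProbabilityMeasure μ →
      ∃! f : H b, LocalSVM.IsSVM L (lam b) μ f) ∧
    -- the influence function of the composed predictor exists and is bounded, uniformly
    ∀ P Q : Measure (X × Y), IsProbabilityMeasure P → IsProbabilityMeasure Q →
      ∃ G : Lp ℝ ∞ P.fst,
        LocalSVM.IsInfluenceFunction R H w L lam g P Q G ∧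
        ‖G‖ ≤ 2 * K * ∑ b, (⨆ x : R b, w b x) * (lam b)⁻¹ * LocalSVM.kernelSup (H b) ^ 2 := by

  have : SecondCountableTopology X := UniformSpace.secondCountable_of_separable X
  have hRm : ∀ b, MeasurableSet (R b) := fun b => (hR b).isClosed.measurableSet
  obtain ⟨M, hM⟩ := hL''b
  have hL : SmoothLoss L K M.toNNReal :=
    { measurable := hLm
      convex := hLconv
      lipschitz := hLip
      differentiable := fun y => (hLC2 y).differentiable two_ne_zero
      differentiable_deriv := fun y =>
        ((contDiff_succ_iff_deriv (n := 1)).1 (hLC2 y)).2.2.differentiable one_ne_zero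
      abs_deriv2_le := fun y t => (hM ⟨(y, t), rfl⟩).trans (Real.le_coe_toNNReal M) }
  have hΦ := fun b => continuous_featureMap (H b) (hkc b)
  have hκ := fun b => norm_featureMap_le (H b) (hkb b)
  refine ⟨fun b μ hμ => ?_, fun P Q hP hQ => ?_⟩
  · obtain ⟨f, hf⟩ := exists_isSVM (μ := μ) hL (hΦ b) (hκ b) (hlam b)
    exact ⟨f, hf, fun g hg => IsSVM.unique hL (hΦ b) (hκ b) (hlam b) hg hf⟩
  set κ : Fin B → ℝ := fun b => kernelSup (A := R b) (H b)
  have hκ0 : ∀ b, 0 ≤ κ b := fun b => kernelSup_nonneg (H b)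
  have hloc : ∀ b, ∃ (f : H b) (F : ℝ → H b) (u : H b), ‖u‖ ≤ K * κ b * (lam b)⁻¹ ∧
      Tendsto (fun ε : ℝ => ε⁻¹ • (F ε - f)) (𝓝[>] 0) (𝓝 u) ∧ (P.fst (R b) ≠ 0 →
        localPredictor (H b) L (lam b) (g b) (regional P (R b)) = f ∧
        ∀ ε ∈ Icc (0 : ℝ) 1,
          localPredictor (H b) L (lam b) (g b) (contaminated P Q (R b) ε) = F ε) := by
    intro b
    by_cases hb : P.fst (R b) = 0
    -- Placeholders on a null region, where the identification with the predictors is not required.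
    · refine ⟨0, 0, 0, ?_, by simp, fun h => absurd hb h⟩
      rw [norm_zero]
      exact mul_nonneg (mul_nonneg K.2 (hκ0 b)) (inv_nonneg.2 (hlam b).le)
    · obtain ⟨f, F, u, hf, hF, hu, hut⟩ := exists_local_influence (Q := Q) (g := g b) (hRm b) hL
        (hkb b) (hkc b) (hlam b) hb
      exact ⟨f, F, u, hu, hut, fun _ => ⟨hf, hF⟩⟩
  choose f F u hu hut hfF using hloc
  -- `composedPredictor` unfolds to `compose` of the local predictors.
  have hmeas : ∀ ν : ∀ b, Measure (R b × Y),
      Measurable (composedPredictor R H w L lam g ν) := fun ν =>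
    measurable_compose hRm hwm fun b => measurable_localPredictor (hkc b) (hg b) (ν b)
  have hGb : ∀ᵐ x ∂P.fst, |compose R w (fun b => u b) x|
      ≤ ∑ b, (⨆ x : R b, w b x) * (κ b * (K * κ b * (lam b)⁻¹)) :=
    ae_abs_compose_le hw01 (fun b => (mul_nonneg (hκ0 b) ((norm_nonneg _).trans (hu b))))
      fun b _ x => (abs_apply_le (hκ b) _ x).trans (mul_le_mul_of_nonneg_left (hu b) (hκ0 b))
  have hGmem : MemLp (compose R w fun b => u b) ∞ P.fst :=
    memLp_top_of_bound (measurable_compose hRm hwm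
      fun b => measurable_coe (hΦ b) (u b)).aestronglyMeasurable _ hGb
  refine ⟨hGmem.toLp _, ⟨?_, fun ε hε => ?_, ?_⟩, ?_⟩
  · refine memLp_top_of_bound (hmeas _).aestronglyMeasurable _
      (ae_abs_compose_le (c := fun b => κ b * ‖f b‖) hw01
        (fun b => mul_nonneg (hκ0 b) (norm_nonneg _)) fun b hb x => ?_)
    rw [(hfF b hb).1]
    exact abs_apply_le (hκ b) _ x
  · refine memLp_top_of_bound (hmeas _).aestronglyMeasurable _
      (ae_abs_compose_le (c := fun b => κ b * ‖F b ε‖) hw01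
        (fun b => mul_nonneg (hκ0 b) (norm_nonneg _)) fun b hb x => ?_)
    rw [(hfF b hb).2 ε hε]
    exact abs_apply_le (hκ b) _ x
  -- By linearity of `compose`, this sum of local RKHS errors dominates the `L^∞` error of the
  -- difference quotient.
  · have hρ : Tendsto (fun ε : ℝ => ENNReal.ofReal (∑ b, (⨆ x : R b, w b x) *
        (κ b * ‖ε⁻¹ • (F b ε - f b) - u b‖))) (𝓝[>] 0) (𝓝 0) := by
      have h := tendsto_finsetSum Finset.univ fun b (_ : b ∈ Finset.univ) =>
        ((tendsto_iff_norm_sub_tendsto_zero.1 (hut b)).const_mul (κ b)).const_mul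
          (⨆ x : R b, w b x)
      simp only [mul_zero, Finset.sum_const_zero] at h
      simpa only [ENNReal.ofReal_zero] using ENNReal.tendsto_ofReal h
    refine tendsto_of_tendsto_of_tendsto_of_le_of_le' tendsto_const_nhds hρ
      (Eventually.of_forall fun _ => zero_le) ?_
    filter_upwards [Ioo_mem_nhdsGT (one_pos : (0 : ℝ) < 1)] with ε hε
    refine eLpNorm_top_le_ofReal ?_
    filter_upwards [hGmem.coeFn_toLp, ae_abs_compose_le (μ := P.fst) (R := R) (w := w)
      (V := fun b z =>
        (localPredictor (H b) L (lam b) (g b) (contaminated P Q (R b) ε) z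
          - localPredictor (H b) L (lam b) (g b) (regional P (R b)) z) / ε - u b z)
      (c := fun b => κ b * ‖ε⁻¹ • (F b ε - f b) - u b‖) hw01
      (fun b => mul_nonneg (hκ0 b) (norm_nonneg _)) (fun b hb x => by
        rw [(hfF b hb).1, (hfF b hb).2 ε (Ioo_subset_Icc_self hε)]
        have h := abs_apply_le (hκ b) (ε⁻¹ • (F b ε - f b) - u b) x
        simpa [div_eq_inv_mul] using h)] with x hx1 hx2
    rw [hx1]
    rw [← compose_sub_div_sub] at hx2
    exact hx2
  · have hsum : ∑ b, (⨆ x : R b, w b x) * (κ b * (K * κ b * (lam b)⁻¹))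
        = K * ∑ b, (⨆ x : R b, w b x) * (lam b)⁻¹ * κ b ^ 2 := by
      rw [Finset.mul_sum]
      exact Finset.sum_congr rfl fun b _ => by ring
    have hnn : 0 ≤ K * ∑ b, (⨆ x : R b, w b x) * (lam b)⁻¹ * κ b ^ 2 :=
      mul_nonneg K.2 (Finset.sum_nonneg fun b _ => mul_nonneg (mul_nonneg
        (Real.iSup_nonneg fun x => (hw01 b x).1) (inv_nonneg.2 (hlam b).le)) (sq_nonneg _))
    rw [hsum] at hGb
    rw [Lp.norm_toLp]
    refine (ENNReal.toReal_le_of_le_ofReal hnn (eLpNorm_top_le_ofReal hGb)).trans ?_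
    -- The estimate obtained has constant `K`; the factor 2 is slack, absorbed by `hnn`.
    rw [mul_assoc]
    linarith
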